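/- Let $d\ge 1$, let $\varphi:\{-1,1\}^d\to\{-1,1\}$, and let $\Phi:\{-1,1\}^{\mathbf Z}\to\{-1,1\}^{\mathbf Z}$ be defined by $\Phi(x)_n=\varphi(x_{n-d},\dots,x_{n-1})\,x_n$. For $\alpha\in\{-1,1\}$ let $f_\alpha(x_1,\dots,x_d)=(x_2,\dots,x_d,\alpha\varphi(x_1,\dots,x_d))$ on $E_d=\{-1,1\}^d$. Two elements $a,b\in E_d$ are called accordable if $f_{\alpha_l}\circ\dots\circ f_{\alpha_1}(a)=f_{\alpha_l}\circ\dots\circ f_{\alpha_1}(b)$ for some finite sequence of signs $\alpha_1,\dots,\alpha_l$; let $M$ be the maximal number of pairwise non-accordable elements of $E_d$. Consider the Markov chain on the subsets of $E_d$ which moves from $A$ to $f_{+1}(A)$ or to $f_{-1}(A)$ with probability $\tfrac12$ each, and let $\mathcal C$ be the set of its recurrent states having exactly $M$ elements. For a sequence $x$ indexed by $\mathbf Z$ write $x_{n]}=(x_{n+k})_{k\in-\mathbf N}$. A coin-tossing game is a sequence $(\varepsilon_n)_{n\in\mathbf Z}$ of independent random variables, uniform on $\{-1,1\}$. A Markov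 chain $(X_n)_{n\in\mathbf Z}$ on $\mathcal C$ is governed by the coin-tossing game $(\eta_n)_{n\in\mathbf Z}$ if almost surely $X_n=f_{\eta_n}(X_{n-1})$ for all $n$, and, for every $n$, $\eta_n$ is independent of $(X_k)_{k<n}$. Let $\varepsilon=(\varepsilon_n)_{n\in\mathbf Z}$ be a coin-tossing game. (a) There is a Markov chain on $\mathcal C$ governed by $\Phi(\varepsilon)$. (b) For every Markov chain $(X_n)_{n\in\mathbf Z}$ on $\mathcal C$ governed by a coin-tossing game $(\eta_n)_{n\in\mathbf Z}$ (on any probability space), there is a measurable map $F:\{-1,1\}^{-\mathbf N}\to\mathcal C$ such that almost surely $X_n=F(\eta_{n]})$ for all $n\in\mathbf Z$. For every such $F$, almost surely, for all $n\in\mathbf Z$, the conditional law of $(\varepsilon_{n-d+1},\dots,\varepsilon_n)$ given $\Phi(\varepsilon)$ is the uniform law on the $M$-element set $F(\Phi(\varepsilon)_{n]})$. (c) In particular, the loss of information is uniform on $M$ values: almost surely, the conditional law of the whole sequence $\varepsilon$ given $\Phi(\varepsilon)$ is the uniform law on a set of $M$ elements. -/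

import Mathlib

open MeasureTheory ProbabilityTheory Filter

/-! Signs `{-1, 1}` are the units `ℤˣ`; sequences indexed by `-ℕ` are functions `y : ℕ → ℤˣ`,
with `y k` standing for the term of index `-k`. -/

namespace CoinToss

instance : DiscreteMeasurableSpace ℤˣ where
  forall_measurableSet s :=
    ⟨Units.val '' s, MeasurableSet.of_discrete, Set.preimage_image_eq s Units.val_injective⟩

/-- The finite set `E_d = {-1, 1}^d`. -/
abbrev E (d : ℕ) : Type := Fin d → ℤˣ

/-- The block `(x_{n-d+1}, …, x_n)` of a two-sided sequence. -/
def block (d : ℕ) (x : ℤ → ℤˣ) (n : ℤ) : E d := fun i => x (n - d + 1 + (i : ℕ))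

/-- The past `(x_{n+k})_{k ∈ -ℕ}` of a two-sided sequence, up to and including time `n`. -/
def past (x : ℤ → ℤˣ) (n : ℤ) : ℕ → ℤˣ := fun k => x (n - k)

/-- The homogeneous transformation of finite length
`Φ(x) = (φ(x_{n-d}, …, x_{n-1}) x_n)_{n ∈ ℤ}`. -/
def transform {d : ℕ} (φ : E d → ℤˣ) (x : ℤ → ℤˣ) : ℤ → ℤˣ :=
  fun n => φ (block d x (n - 1)) * x n

/-- The map `f_α(x_1, …, x_d) = (x_2, …, x_d, α φ(x_1, …, x_d))`. -/
def step {d : ℕ} (φ : E d → ℤˣ) (α : ℤˣ) (x : E d) : E d :=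
  fun i => if h : (i : ℕ) + 1 < d then x ⟨i + 1, h⟩ else α * φ x

/-- `steps φ [α_1, …, α_l]` is the composite `f_{α_l} ∘ ⋯ ∘ f_{α_1}`. -/
def steps {d : ℕ} (φ : E d → ℤˣ) (w : List ℤˣ) (x : E d) : E d :=
  w.foldl (fun y α => step φ α y) x

/-- `a` and `b` are *accordable*: some composite `f_{α_l} ∘ ⋯ ∘ f_{α_1}` takes the same value
at `a` and `b`. -/
def Accordable {d : ℕ} (φ : E d → ℤˣ) (a b : E d) : Prop :=
  ∃ w : List ℤˣ, steps φ w a = steps φ w b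

/-- `M`: the maximal number of pairwise non-accordable elements of `E_d`. -/
noncomputable def maxNonAccordable {d : ℕ} (φ : E d → ℤˣ) : ℕ :=
  sSup {m : ℕ | ∃ A : Finset (E d),
    (A : Set (E d)).Pairwise (fun a b => ¬ Accordable φ a b) ∧ A.card = m}

/-- The uniform law on `{-1, 1}`. -/
noncomputable def signLaw : Measure ℤˣ := uniformOn Set.univ

/-- A coin-tossing game indexed by `ι`: independent signs with uniform law on `{-1, 1}`. -/
structure IsCoinTossing {ι Ω : Type*} [MeasurableSpace Ω] (P : Measure Ω)
    (ε : ι → Ω → ℤˣ) : Prop where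
  measurable : ∀ n, Measurable (ε n)
  indep : iIndepFun ε P
  law : ∀ n, P.map (ε n) = signLaw

/-- The chain on subsets of `E_d` started at `A` and driven by the signs `η 0, η 1, …`:
`X_0 = A` and `X_{n+1} = f_{η n}(X_n)` (direct image). -/
def setChain {d : ℕ} (φ : E d → ℤˣ) (η : ℕ → ℤˣ) (A : Set (E d)) : ℕ → Set (E d)
  | 0 => A
  | n + 1 => step φ (η n) '' setChain φ η A n

/-- The subset `A` of `E_d` is a recurrent state of the chain on subsets: started at `A` and
driven by independent uniform signs, the chain almost surely visits `A` infinitely often. -/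
def IsRecurrentState {d : ℕ} (φ : E d → ℤˣ) (A : Set (E d)) : Prop :=
  ∀ᵐ η ∂(Measure.infinitePi (fun _ : ℕ => signLaw)), ∃ᶠ n in atTop, setChain φ η A n = A

/-- `𝒞`: the recurrent states with exactly `M` elements. -/
def recurrentClass {d : ℕ} (φ : E d → ℤˣ) : Set (Set (E d)) :=
  {A | IsRecurrentState φ A ∧ A.ncard = maxNonAccordable φ}

/-- `(X_n)_{n ∈ ℤ}` is a Markov chain on `𝒞` governed by the coin-tossing game `(η_n)_{n ∈ ℤ}`:
almost surely `X_n = f_{η_n}(X_{n-1})` for all `n`, and `η_n` is independent of `(X_k)_{k < n}`. -/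
structure IsGovernedChain {d : ℕ} (φ : E d → ℤˣ) {Ω : Type*} [MeasurableSpace Ω] (P : Measure Ω)
    (η : ℤ → Ω → ℤˣ) (X : ℤ → Ω → recurrentClass φ) : Prop where
  coinTossing : IsCoinTossing P η
  measurable : ∀ n, Measurable (X n)
  rec_eq : ∀ᵐ ω ∂P, ∀ n, (X n ω : Set (E d)) = step φ (η n ω) '' (X (n - 1) ω : Set (E d))
  indep_past : ∀ n, IndepFun (η n) (fun ω (k : Set.Iio n) => X k ω) P

/-- `F : {-1, 1}^{-ℕ} → 𝒞` is measurable and expresses the chain `X` through the past of its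
driving signs: almost surely `X_n` is the value of `F` at the past of `η` up to `n`, for all `n`. -/
structure IsPastMap {d : ℕ} (φ : E d → ℤˣ) {Ω : Type*} [MeasurableSpace Ω] (P : Measure Ω)
    (η : ℤ → Ω → ℤˣ) (X : ℤ → Ω → recurrentClass φ) (F : (ℕ → ℤˣ) → recurrentClass φ) :
    Prop where
  measurable : Measurable F
  eq_past : ∀ᵐ ω ∂P, ∀ n, X n ω = F (past (fun k => η k ω) n)

end CoinToss

/-! Since signs square to 1, the block of `x` at time `n` is the image of its block at time `n - 1`
under `step φ (Φ(x)_n)`. Thus Φ(ε), itself a coin-tossing game, drives the blocks of ε through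
random words. Everything rests on words of minimal rank. That rank is M
(`exists_ncard_wordRange_eq`), and prefixing more letters to such a word does not change its image.
Almost surely the past of the driving signs contains one, so the images of longer and longer pasts
stabilise to a set of M states. This set is `pastMap`, and every governed chain must equal it. The
block at time `n - m` is uniform and independent of the signs Φ(ε) after that time
(`indepFun_block_transform`). A word of rank M has fibres of equal size, because M times any fibre
is at most `2^d`; hence it sends the uniform law to the uniform law on its image
(`map_steps_uniformOn`). Letting `m` grow gives the conditional law of a block. For the whole
sequence, each driving sign acts bijectively between successive values of `pastMap`, so one block
determines all the others, past and future. -/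

namespace CoinToss

/-! ### Words, their ranks and the number M -/

section Words

variable {d : ℕ} {φ : E d → ℤˣ}

@[simp] lemma steps_nil (x : E d) : steps φ [] x = x := rfl

@[simp] lemma steps_cons (α : ℤˣ) (w : List ℤˣ) (x : E d) :
    steps φ (α :: w) x = steps φ w (step φ α x) := rfl

lemma steps_append (u w : List ℤˣ) (x : E d) :
    steps φ (u ++ w) x = steps φ w (steps φ u x) := by
  simp [steps, List.foldl_append]

/-- The basic recursion: `φ` occurs twice in the new last entry and cancels. -/
lemma block_eq_step (x : ℤ → ℤˣ) (n : ℤ) :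
    block d x n = step φ (transform φ x n) (block d x (n - 1)) := by
  funext i
  simp only [block, step, transform]
  split_ifs with h
  · congr 1; push_cast; ring
  · have : n - d + 1 + (i : ℕ) = n := by have := i.2; omega
    rw [this, mul_right_comm, Int.units_mul_self, one_mul]

/-- The word `[y_{m-1}, …, y_0]` read off a past. -/
def pastWord (y : ℕ → ℤˣ) (m : ℕ) : List ℤˣ := (List.ofFn fun i : Fin m => y i).reverse

@[simp] lemma pastWord_zero (y : ℕ → ℤˣ) : pastWord y 0 = [] := rfl

lemma pastWord_succ (y : ℕ → ℤˣ) (m : ℕ) : pastWord y (m + 1) = y m :: pastWord y m := by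
  rw [pastWord, List.ofFn_succ']
  simp [pastWord]

lemma pastWord_succ' (y : ℕ → ℤˣ) (m : ℕ) :
    pastWord y (m + 1) = pastWord (fun k => y (k + 1)) m ++ [y 0] := by
  simp [pastWord, List.ofFn_succ]

lemma pastWord_add (y : ℕ → ℤˣ) (k l : ℕ) :
    pastWord y (k + l) = pastWord (fun i => y (k + i)) l ++ pastWord y k := by
  induction l with
  | zero => simp
  | succ l ih => rw [← add_assoc, pastWord_succ, ih, pastWord_succ]; simp

lemma past_succ (x : ℤ → ℤˣ) (n : ℤ) (k : ℕ) : past x n (k + 1) = past x (n - 1) k := by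
  simp only [past]; congr 1; push_cast; ring

@[simp] lemma past_zero (x : ℤ → ℤˣ) (n : ℤ) : past x n 0 = x n := by simp [past]

lemma pastWord_past_succ (x : ℤ → ℤˣ) (n : ℤ) (m : ℕ) :
    pastWord (past x n) (m + 1) = pastWord (past x (n - 1)) m ++ [x n] := by
  rw [pastWord_succ', past_zero, funext (past_succ x n)]

lemma block_eq_steps (x : ℤ → ℤˣ) (n : ℤ) (m : ℕ) :
    block d x n = steps φ (pastWord (past (transform φ x) n) m) (block d x (n - m)) := by
  induction m with
  | zero => simp
  | succ m ih =>
    rw [ih, pastWord_succ, steps_cons, block_eq_step (φ := φ) x (n - m), past]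
    congr 3; push_cast; ring

/-- Words of length `d` lead from any state to any other. -/
lemma exists_steps_eq (φ : E d → ℤˣ) (a b : E d) :
    ∃ v : E d, steps φ (List.ofFn v).reverse a = b := by
  -- This sequence carries `a` at times `1 - d, …, 0` and `b` at times `1, …, d`; its transform at
  -- times `1, …, d` spells the required word.
  let x : ℤ → ℤˣ := fun k =>
    if h : 0 < k then (if h' : (k - 1).toNat < d then b ⟨_, h'⟩ else 1)
    else (if h' : (k + d - 1).toNat < d then a ⟨_, h'⟩ else 1)
  have h0 : block d x (d - d) = a := by
    funext i
    have := i.2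
    simp only [block, x]
    rw [dif_neg (by omega), dif_pos (by omega)]
    congr 2; omega
  have h1 : block d x d = b := by
    funext i
    have := i.2
    simp only [block, x]
    rw [dif_pos (by omega), dif_pos (by omega)]
    congr 2; omega
  refine ⟨fun i => past (transform φ x) d i, ?_⟩
  have := block_eq_steps (φ := φ) x d d
  rw [h0, h1] at this
  exact this.symm

/-- The image of `E_d` under a word. -/
def wordRange (φ : E d → ℤˣ) (w : List ℤˣ) : Set (E d) := Set.range (steps φ w)

lemma wordRange_append (u w : List ℤˣ) :
    wordRange φ (u ++ w) = steps φ w '' wordRange φ u := by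
  rw [wordRange, wordRange, ← Set.range_comp]
  exact congrArg _ (funext fun x => steps_append u w x)

lemma wordRange_append_subset (u w : List ℤˣ) : wordRange φ (u ++ w) ⊆ wordRange φ w := by
  rw [wordRange_append]; exact Set.image_subset_range _ _

/-- A word cannot merge two non-accordable states, so it is injective on `A`. -/
lemma card_le_ncard_wordRange {A : Finset (E d)}
    (hA : (A : Set (E d)).Pairwise (fun a b => ¬ Accordable φ a b)) (w : List ℤˣ) :
    A.card ≤ (wordRange φ w).ncard := by
  have inj : Set.InjOn (steps φ w) A := fun a ha b hb hab => by
    by_contra hne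
    exact hA ha hb hne ⟨w, hab⟩
  rw [← Set.ncard_coe_finset, ← inj.ncard_image]
  exact Set.ncard_le_ncard (Set.image_subset_range _ _) (Set.toFinite _)

lemma maxNonAccordable_le_ncard (w : List ℤˣ) :
    maxNonAccordable φ ≤ (wordRange φ w).ncard := by
  refine csSup_le ⟨0, ∅, by simp, rfl⟩ ?_
  rintro m ⟨A, hA, rfl⟩
  exact card_le_ncard_wordRange hA w

lemma ncard_le_maxNonAccordable {A : Set (E d)}
    (hA : A.Pairwise (fun a b => ¬ Accordable φ a b)) : A.ncard ≤ maxNonAccordable φ := by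
  classical
  refine le_csSup ⟨Fintype.card (E d), ?_⟩ ⟨A.toFinset, by simpa using hA, ?_⟩
  · rintro m ⟨A, -, rfl⟩
    exact Finset.card_le_univ A
  · rw [Set.ncard_eq_toFinset_card']

/-- The elements of the image of a word of minimal rank are pairwise non-accordable. -/
lemma pairwise_of_minimal {w : List ℤˣ}
    (hw : ∀ u, (wordRange φ w).ncard ≤ (wordRange φ u).ncard) :
    (wordRange φ w).Pairwise (fun a b => ¬ Accordable φ a b) := by
  rintro a ha b hb hab ⟨u, hu⟩
  -- Merging `a` and `b` by `u` would make the rank drop strictly below the minimum.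
  have h := hw (w ++ u)
  rw [wordRange_append] at h
  exact hab (Set.injOn_of_ncard_image_eq
    (le_antisymm (Set.ncard_image_le (Set.toFinite _)) h) (Set.toFinite _) ha hb hu)

lemma exists_ncard_wordRange_eq (φ : E d → ℤˣ) :
    ∃ w, (wordRange φ w).ncard = maxNonAccordable φ := by
  obtain ⟨w, -, hw⟩ := WellFounded.has_min (measure fun w => (wordRange φ w).ncard).wf
    Set.univ ⟨[], trivial⟩
  refine ⟨w, le_antisymm (ncard_le_maxNonAccordable (pairwise_of_minimal fun u => ?_))
    (maxNonAccordable_le_ncard w)⟩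
  exact not_lt.1 (hw u trivial)

lemma maxNonAccordable_pos (φ : E d → ℤˣ) : 0 < maxNonAccordable φ := by
  obtain ⟨w, hw⟩ := exists_ncard_wordRange_eq φ
  rw [← hw, Set.ncard_pos]
  exact Set.range_nonempty _

lemma eq_of_accordable {w : List ℤˣ} (hw : (wordRange φ w).ncard = maxNonAccordable φ)
    {a b : E d} (ha : a ∈ wordRange φ w) (hb : b ∈ wordRange φ w) (hab : Accordable φ a b) :
    a = b := by
  by_contra hne
  exact pairwise_of_minimal (fun u => hw ▸ maxNonAccordable_le_ncard u) ha hb hne hab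

/-- A set of states merged by a word has at most `2^d / M` elements. -/
lemma maxNonAccordable_mul_card_fiber_le (w : List ℤˣ) (c : E d) :
    maxNonAccordable φ * (Finset.univ.filter fun x => steps φ w x = c).card
      ≤ Fintype.card (E d) := by
  classical
  obtain ⟨u, hu⟩ := exists_ncard_wordRange_eq φ
  -- Pairs (state in the image of `u`, state in the fibre) are encoded by the word `v` of length `d`
  -- joining them. Two pairs with the same word have starting points sent into the fibre and then
  -- merged by `w`; these are accordable, hence equal, and then so are the endpoints.
  choose v hv using exists_steps_eq φ
  rw [← hu, Set.ncard_eq_toFinset_card', ← Finset.card_product]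
  refine Finset.card_le_card_of_injOn (fun p => v p.1 p.2) (fun _ _ => Finset.mem_univ _) ?_
  rintro ⟨i, t⟩ hit ⟨j, s⟩ hjs h
  simp only [Finset.coe_product, Set.coe_toFinset, Finset.coe_filter, Finset.mem_univ, true_and,
    Set.mem_prod, Set.mem_ofPred_eq] at hit hjs h
  have hij : i = j := by
    refine eq_of_accordable hu hit.1 hjs.1 ⟨(List.ofFn (v i t)).reverse ++ w, ?_⟩
    rw [steps_append, hv, hit.2, h, steps_append, hv, hjs.2]
  subst hij
  rw [Prod.mk.injEq]
  exact ⟨rfl, by rw [← hv i t, h, hv]⟩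

/-- The M fibres partition `E d` and each has at most `2^d / M` elements, so equality holds for all
of them. -/
lemma maxNonAccordable_mul_card_fiber_eq {w : List ℤˣ}
    (hw : (wordRange φ w).ncard = maxNonAccordable φ) {c : E d} (hc : c ∈ wordRange φ w) :
    maxNonAccordable φ * (Finset.univ.filter fun x => steps φ w x = c).card
      = Fintype.card (E d) := by
  classical
  have hsum : ∑ c ∈ (wordRange φ w).toFinset,
      maxNonAccordable φ * (Finset.univ.filter fun x => steps φ w x = c).card
        = ∑ c ∈ (wordRange φ w).toFinset, Fintype.card (E d) := by
    rw [← Finset.mul_sum, ← Finset.card_eq_sum_card_fiberwise (fun x _ => by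
      simp only [Set.coe_toFinset]; exact ⟨x, rfl⟩),
      Finset.sum_const, ← Set.ncard_eq_toFinset_card', hw, smul_eq_mul, Finset.card_univ]
  exact (Finset.sum_eq_sum_iff_of_le fun c _ => maxNonAccordable_mul_card_fiber_le w c).1 hsum c
    (by simpa using hc)

/-- A word of rank `M` maps the uniform law on `E_d` to the uniform law on its image. -/
lemma map_steps_uniformOn {w : List ℤˣ} (hw : (wordRange φ w).ncard = maxNonAccordable φ) :
    (uniformOn (Set.univ : Set (E d))).map (steps φ w) = uniformOn (wordRange φ w) := by
  classical
  refine Measure.ext_of_singleton fun c => ?_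
  rw [Measure.map_apply (measurable_of_finite _) (measurableSet_singleton c)]
  have h1 : steps φ w ⁻¹' {c} = ((Finset.univ.filter fun x => steps φ w x = c : Finset _) :
    Set (E d)) := by ext; simp
  have h2 : wordRange φ w = ((wordRange φ w).toFinset : Set (E d)) := by simp
  rw [h1, uniformOn_univ, Measure.count_apply_finset, h2, ← Finset.coe_singleton,
    uniformOn_apply_finset, ← Set.ncard_eq_toFinset_card', hw]
  by_cases hc : c ∈ wordRange φ w
  · rw [Finset.inter_singleton_of_mem (by simpa using hc), Finset.card_singleton,
      ENNReal.div_eq_div_iff (by simpa using (maxNonAccordable_pos φ).ne') (by simp)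
        (by simp) (by simp)]
    rw [Nat.cast_one, mul_one]
    exact_mod_cast maxNonAccordable_mul_card_fiber_eq hw hc
  · rw [Finset.inter_singleton_of_notMem (by simpa using hc), Finset.filter_false_of_mem]
    · simp
    · exact fun x _ h => hc ⟨x, h⟩

end Words
-- Coin-tossing games and recurrence of patterns
section CoinTossing

instance : IsProbabilityMeasure signLaw := by unfold signLaw; infer_instance

lemma signLaw_singleton_ne_zero (a : ℤˣ) : signLaw {a} ≠ 0 := by
  rw [signLaw, uniformOn_univ]; simp

/-- Functions of disjoint parts of an independent family are independent. -/
lemma iIndepFun_indepFun_of_disjoint {ι Ω β : Type*} [MeasurableSpace Ω] [MeasurableSpace β]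
    {P : Measure Ω} {X : ι → Ω → β} (h : iIndepFun X P) (hX : ∀ i, Measurable (X i))
    {S T : Set ι} (hST : Disjoint S T) :
    IndepFun (fun ω (k : S) => X k ω) (fun ω (k : T) => X k ω) P := by
  have key (S : Set ι) : MeasurableSpace.comap (fun ω (k : S) => X k ω) inferInstance ≤
      ⨆ i ∈ S, MeasurableSpace.comap (X i) inferInstance := by
    rw [MeasurableSpace.pi, MeasurableSpace.comap_iSup]
    refine iSup_le fun k => ?_
    rw [MeasurableSpace.comap_comp]
    exact le_iSup₂_of_le (k : ι) k.2 le_rfl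
  rw [IndepFun_iff_Indep]
  exact indep_of_indep_of_le_left (indep_of_indep_of_le_right
    (indep_iSup_of_disjoint (fun i => (hX i).comap_le) h.iIndep hST) (key T)) (key S)

variable {ι Ω : Type*} [MeasurableSpace Ω] {P : Measure Ω}

lemma IsCoinTossing.map_eq {ε : ι → Ω → ℤˣ} (h : IsCoinTossing P ε) :
    P.map (fun ω k => ε k ω) = Measure.infinitePi fun _ => signLaw := by
  rw [h.indep.map_fun_eq_infinitePi_map h.measurable, funext h.law]

lemma isCoinTossing_of_map_eq [IsProbabilityMeasure P] {ε : ι → Ω → ℤˣ} (hm : ∀ n, Measurable (ε n))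
    (h : P.map (fun ω k => ε k ω) = Measure.infinitePi fun _ => signLaw) :
    IsCoinTossing P ε := by
  have law (n) : P.map (ε n) = signLaw := by
    rw [← Measure.infinitePi_map_eval (fun _ : ι => signLaw) n, ← h,
      Measure.map_map (measurable_pi_apply n) (measurable_pi_iff.2 hm)]
    rfl
  refine ⟨hm, ?_, law⟩
  rw [iIndepFun_iff_map_fun_eq_infinitePi_map hm, h, funext law]

lemma IsCoinTossing.precomp {κ : Type*} {ε : ι → Ω → ℤˣ} (h : IsCoinTossing P ε) {g : κ → ι}
    (hg : g.Injective) : IsCoinTossing P fun k => ε (g k) :=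
  ⟨fun _ => h.measurable _, h.indep.precomp hg, fun _ => h.law _⟩

lemma isCoinTossing_infinitePi :
    IsCoinTossing (Measure.infinitePi fun _ : ι => signLaw) fun k (η : ι → ℤˣ) => η k :=
  isCoinTossing_of_map_eq (fun k => measurable_pi_apply k) Measure.map_id

/-- Every finite pattern appears infinitely often in a coin-tossing game. -/
lemma IsCoinTossing.frequently_pattern {η : ℕ → Ω → ℤˣ} (h : IsCoinTossing P η) (v : ℕ → ℤˣ)
    (l : ℕ) : ∀ᵐ ω ∂P, ∃ᶠ n in atTop, ∀ i < l, η (n + i) ω = v i := by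
  have := h.indep.isProbabilityMeasure
  -- Disjoint windows give independent events of the same positive probability, to which
  -- Borel–Cantelli applies. The width `l + 1` stays positive for the empty pattern.
  let g : ℕ × Fin (l + 1) → ℕ := fun p => p.1 * (l + 1) + p.2
  have hg : g.Injective := by
    rintro ⟨a, i⟩ ⟨b, j⟩ hab
    have h1 := congrArg (· / (l + 1)) hab
    have h2 := congrArg (· % (l + 1)) hab
    simp only [g, mul_comm _ (l + 1)] at h1 h2
    rw [Nat.mul_add_div (by omega), Nat.mul_add_div (by omega), Nat.div_eq_of_lt i.2,
      Nat.div_eq_of_lt j.2] at h1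
    rw [Nat.mul_add_mod, Nat.mul_add_mod, Nat.mod_eq_of_lt i.2, Nat.mod_eq_of_lt j.2] at h2
    exact Prod.ext h1 (Fin.ext h2)
  have hind := h.precomp hg
  let A : ℕ × Fin (l + 1) → Set Ω := fun p => η (g p) ⁻¹' {v p.2}
  let s : ℕ → Set Ω := fun j => ⋂ i : Fin (l + 1), A (j, i)
  have hA (p) : MeasurableSet[MeasurableSpace.comap (η (g p)) inferInstance] (A p) :=
    ⟨{v p.2}, measurableSet_singleton _, rfl⟩
  have hA' (p) : MeasurableSet (A p) := (h.measurable _) (measurableSet_singleton _)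
  have hs : ∀ j, MeasurableSet (s j) := fun j => MeasurableSet.iInter fun i => hA' _
  have hPA (p) : P (A p) = signLaw {v p.2} := by
    rw [← h.law (g p), Measure.map_apply (h.measurable _) (measurableSet_singleton _)]
  have hS (S : Finset ℕ) : P (⋂ j ∈ S, s j) = ∏ j ∈ S, ∏ i : Fin (l + 1), P (A (j, i)) := by
    rw [← Finset.prod_product', ← hind.indep.meas_biInter fun p _ => hA p]
    congr 1
    ext ω
    simp [s]
    exact ⟨fun H a b ha => H a ha b, fun H a ha b => H a b ha⟩
  have hPs (j) : P (s j) = ∏ i : Fin (l + 1), signLaw {v i} := by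
    have := hS {j}
    simpa [hPA] using this
  have hlim := measure_limsup_eq_one hs ((iIndepSet_iff_meas_biInter hs).2 fun S => by
      rw [hS]
      refine Finset.prod_congr rfl fun j _ => ?_
      rw [hPs]
      exact Finset.prod_congr rfl fun i _ => hPA _) (by
      simp_rw [hPs]
      exact ENNReal.tsum_const_eq_top_of_ne_zero
        (Finset.prod_ne_zero_iff.2 fun i _ => signLaw_singleton_ne_zero _))
  have hae : ∀ᵐ ω ∂P, ω ∈ limsup s atTop := by
    rwa [← prob_compl_eq_zero_iff (MeasurableSet.measurableSet_limsup hs)] at hlim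
  filter_upwards [hae] with ω hω
  rw [mem_limsup_iff_frequently_mem, frequently_atTop] at hω
  rw [frequently_atTop]
  intro a
  obtain ⟨j, hj, hjs⟩ := hω a
  refine ⟨j * (l + 1), hj.trans (Nat.le_mul_of_pos_right _ l.succ_pos), fun i hi => ?_⟩
  exact Set.mem_iInter.1 hjs ⟨i, by omega⟩

end CoinTossing

/-! ### Invariance of the coin-tossing law under Φ -/

section Transform

variable {d : ℕ} {φ : E d → ℤˣ}

lemma measurable_block (n : ℤ) : Measurable fun x : ℤ → ℤˣ => block d x n :=
  measurable_pi_iff.2 fun _ => measurable_pi_apply _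

lemma measurable_past (n : ℤ) : Measurable fun x : ℤ → ℤˣ => past x n :=
  measurable_pi_iff.2 fun _ => measurable_pi_apply _

lemma measurable_transform_apply (n : ℤ) : Measurable fun x : ℤ → ℤˣ => transform φ x n :=
  ((measurable_of_finite φ).comp (measurable_block (n - 1))).mul (measurable_pi_apply n)

lemma measurable_transform : Measurable (transform φ) :=
  measurable_pi_iff.2 measurable_transform_apply

/-- The sequence which agrees with `x` up to time `s` and with `Φ(x)` afterwards. -/
def hybrid (φ : E d → ℤˣ) (s : ℤ) (x : ℤ → ℤˣ) : ℤ → ℤˣ :=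
  fun k => if k ≤ s then x k else transform φ x k

lemma measurable_hybrid (s : ℤ) : Measurable (hybrid φ s) := by
  refine measurable_pi_iff.2 fun k => ?_
  by_cases h : k ≤ s
  · simpa only [hybrid, h, if_true] using measurable_pi_apply k
  · simpa only [hybrid, h, if_false] using measurable_transform_apply k

lemma map_uniformOn_univ_of_bijective {α : Type*} [Finite α] [MeasurableSpace α]
    [MeasurableSingletonClass α] {T : α → α} (hT : T.Bijective) :
    (uniformOn (Set.univ : Set α)).map T = uniformOn Set.univ := by
  cases nonempty_fintype α
  refine Measure.ext_of_singleton fun c => ?_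
  obtain ⟨b, rfl⟩ := hT.2 c
  have : T ⁻¹' {T b} = {b} := by ext x; simp [hT.1.eq_iff]
  rw [Measure.map_apply (measurable_of_finite _) (measurableSet_singleton _), this,
    uniformOn_univ, uniformOn_univ, Measure.count_singleton, Measure.count_singleton]

lemma pi_signLaw (κ : Type*) [Fintype κ] :
    Measure.pi (fun _ : κ => signLaw) = uniformOn Set.univ := by
  rw [← Set.pi_univ Set.univ, uniformOn_pi]; rfl

lemma block_congr {x y : ℤ → ℤˣ} {n : ℤ} (h : ∀ k, n - d < k → k ≤ n → x k = y k) :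
    block d x n = block d y n := by
  funext i
  have := i.2
  exact h _ (by omega) (by omega)

/-- Coordinates after `s` look back only `d` steps, so never to `a` or before. Unlike Φ, `hybrid`
therefore induces a self-map of a finite window. -/
lemma hybrid_congr {s k a : ℤ} (ha : a + d ≤ s) (hk : a < k) {x y : ℤ → ℤˣ}
    (h : ∀ j, a < j → j ≤ k → x j = y j) : hybrid φ s x k = hybrid φ s y k := by
  unfold hybrid
  split_ifs with hks
  · exact h k hk le_rfl
  · rw [transform, transform, h k hk le_rfl,
      block_congr (y := y) fun j h1 h2 => h j (by omega) (by omega)]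

/-- The entries are recovered from left to right, each `φ` factor being already known; `n` only
measures the progress of the induction. -/
lemma eq_of_hybrid_eq {s a b : ℤ} (ha : a + d ≤ s) {x y : ℤ → ℤˣ}
    (h : ∀ k, a < k → k ≤ b → hybrid φ s x k = hybrid φ s y k) (n : ℕ) :
    ∀ k, a < k → k ≤ b → k ≤ a + n → x k = y k := by
  induction n with
  | zero => intro k h1 _ h3; simp at h3; omega
  | succ n ih =>
    intro k h1 h2 h3
    have hk := h k h1 h2
    unfold hybrid at hk
    split_ifs at hk with hks
    · exact hk
    · rw [transform, transform, block_congr (y := y) fun j _ _ =>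
        ih j (by omega) (by omega) (by push_cast at h3; omega)] at hk
      exact mul_left_cancel hk

/-- The coin-tossing law is invariant under `hybrid φ s`. -/
lemma map_hybrid_infinitePi (s : ℤ) :
    (Measure.infinitePi fun _ : ℤ => signLaw).map (hybrid φ s)
      = Measure.infinitePi fun _ => signLaw := by
  classical
  refine IsProjectiveLimit.unique (P := fun I : Finset ℤ => Measure.pi fun _ : I => signLaw) ?_
    (Measure.isProjectiveLimit_infinitePi _)
  intro I
  obtain ⟨N, hN⟩ : ∃ N : ℕ, (d ≤ N) ∧ I ⊆ Finset.Ioc (s - N) (s + N) := by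
    obtain ⟨u, hu⟩ := I.bddAbove
    obtain ⟨l, hl⟩ := I.bddBelow
    refine ⟨d + (u - s).toNat + (s - l).toNat + 1, by omega, fun k hk => ?_⟩
    have h1 := hu hk
    have h2 := hl hk
    rw [Finset.mem_Ioc]
    push_cast
    omega
  -- On this window the map is an injection of a finite set into itself, so it preserves the uniform
  -- law.
  set W := Finset.Ioc (s - N : ℤ) (s + N) with hW
  let ext (u : W → ℤˣ) : ℤ → ℤˣ := fun k => if h : k ∈ W then u ⟨k, h⟩ else 1
  have ext_res (x : ℤ → ℤˣ) {k} (hk : k ∈ W) : ext (W.restrict x) k = x k := by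
    simp [ext, hk]
  let T (u : W → ℤˣ) : W → ℤˣ := W.restrict (hybrid φ s (ext u))
  have hT : W.restrict ∘ hybrid φ s = T ∘ W.restrict := by
    funext x k
    have hk : s - N < (k : ℤ) ∧ (k : ℤ) ≤ s + N := Finset.mem_Ioc.1 k.2
    refine hybrid_congr (a := s - N) (by omega) hk.1 fun j h1 h2 => (ext_res x ?_).symm
    rw [hW, Finset.mem_Ioc]
    omega
  have hTinj : T.Injective := by
    intro u v huv
    funext k
    have hk : s - N < (k : ℤ) ∧ (k : ℤ) ≤ s + N := Finset.mem_Ioc.1 k.2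
    have := eq_of_hybrid_eq (φ := φ) (s := s) (a := s - N) (b := s + N) (by omega)
      (x := ext u) (y := ext v)
      (fun j h1 h2 => congrFun huv ⟨j, by rw [hW, Finset.mem_Ioc]; omega⟩)
      (2 * N) k hk.1 hk.2 (by push_cast; omega)
    simpa [ext] using this
  have hres : (I.restrict : (ℤ → ℤˣ) → (I → ℤˣ)) = Finset.restrict₂ hN.2 ∘ W.restrict := rfl
  change _ = Measure.pi fun _ : I => signLaw
  rw [← Measure.infinitePi_map_restrict (fun _ : ℤ => signLaw), hres,
    ← Measure.map_map (by fun_prop) (by fun_prop), ← Measure.map_map (by fun_prop) (by fun_prop),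
    Measure.map_map (by fun_prop) (measurable_hybrid s), hT,
    ← Measure.map_map (measurable_of_finite _) (by fun_prop), Measure.infinitePi_map_restrict,
    pi_signLaw, map_uniformOn_univ_of_bijective (Finite.injective_iff_bijective.1 hTinj)]

/-- The coin-tossing law is invariant under `Φ`. -/
lemma map_transform_infinitePi :
    (Measure.infinitePi fun _ : ℤ => signLaw).map (transform φ)
      = Measure.infinitePi fun _ => signLaw := by
  refine IsProjectiveLimit.unique (P := fun I : Finset ℤ => Measure.pi fun _ : I => signLaw) ?_
    (Measure.isProjectiveLimit_infinitePi _)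
  intro I
  obtain ⟨l, hl⟩ := I.bddBelow
  -- A finite set of times cannot distinguish Φ from a hybrid that starts before it.
  have hres : I.restrict ∘ transform φ = I.restrict ∘ hybrid φ (l - 1) := by
    funext x k
    have : ¬ (k : ℤ) ≤ l - 1 := by have := hl k.2; omega
    simp [hybrid, this]
  rw [Measure.map_map (by fun_prop) measurable_transform, hres,
    ← Measure.map_map (by fun_prop) (measurable_hybrid _), map_hybrid_infinitePi,
    Measure.infinitePi_map_restrict]

variable {Ω : Type*} [MeasurableSpace Ω] {P : Measure Ω}
  {ε : ℤ → Ω → ℤˣ}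

lemma IsCoinTossing.measurable_seq {ι : Type*} {ε : ι → Ω → ℤˣ} (h : IsCoinTossing P ε) :
    Measurable fun ω k => ε k ω :=
  measurable_pi_iff.2 h.measurable

lemma IsCoinTossing.hybrid [IsProbabilityMeasure P] (h : IsCoinTossing P ε) (φ : E d → ℤˣ) (s : ℤ) :
    IsCoinTossing P fun n ω => hybrid φ s (fun k => ε k ω) n := by
  have hm := (measurable_hybrid (φ := φ) s).comp h.measurable_seq
  refine isCoinTossing_of_map_eq (measurable_pi_iff.1 hm) ?_
  rw [← map_hybrid_infinitePi (φ := φ) s, ← h.map_eq,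
    Measure.map_map (measurable_hybrid s) h.measurable_seq]
  rfl

/-- `Φ(ε)` is a coin-tossing game. -/
lemma IsCoinTossing.transform [IsProbabilityMeasure P] (h : IsCoinTossing P ε) (φ : E d → ℤˣ) :
    IsCoinTossing P fun n ω => transform φ (fun k => ε k ω) n := by
  have hm := (measurable_transform (φ := φ)).comp h.measurable_seq
  refine isCoinTossing_of_map_eq (measurable_pi_iff.1 hm) ?_
  rw [← map_transform_infinitePi (φ := φ), ← h.map_eq,
    Measure.map_map measurable_transform h.measurable_seq]
  rfl

/-- The hybrid sequence is a coin-tossing game made of ε up to `s` and of Φ(ε) after `s`;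
independence is read off by cutting it at `s`. -/
lemma IsCoinTossing.indepFun_block_transform [IsProbabilityMeasure P] (h : IsCoinTossing P ε) (φ : E d → ℤˣ) (s : ℤ) :
    IndepFun (fun ω => block d (fun k => ε k ω) s)
      (fun ω (k : Set.Ioi s) => CoinToss.transform φ (fun k => ε k ω) k) P := by
  have hh := h.hybrid φ s
  have hdisj : Disjoint (Set.Iic s) (Set.Ioi s) := Set.Iic_disjoint_Ioi le_rfl
  have hi := iIndepFun_indepFun_of_disjoint hh.indep hh.measurable hdisj
  have hle (i : Fin d) : s - d + 1 + (i : ℕ) ≤ s := by have := i.2; omega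
  have h1 : Measurable fun (u : Set.Iic s → ℤˣ) (i : Fin d) => u ⟨s - d + 1 + (i : ℕ), hle i⟩ :=
    measurable_pi_iff.2 fun i => measurable_pi_apply _
  convert hi.comp h1 measurable_id using 1
  · funext ω i
    simp [block, CoinToss.hybrid, hle i]
  · funext ω k
    have : ¬ (k : ℤ) ≤ s := not_le.2 k.2
    simp [CoinToss.hybrid, this]

lemma IsCoinTossing.map_block (h : IsCoinTossing P ε) (s : ℤ) :
    P.map (fun ω => block d (fun k => ε k ω) s) = uniformOn Set.univ := by
  have hg : Function.Injective fun i : Fin d => s - d + 1 + (i : ℕ) := fun i j hij => by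
    simpa [Fin.ext_iff] using hij
  rw [← pi_signLaw, ← Measure.infinitePi_eq_pi, ← (h.precomp hg).map_eq]
  rfl

lemma IsCoinTossing.map_past (h : IsCoinTossing P ε) (n : ℤ) :
    P.map (fun ω => past (fun k => ε k ω) n) = Measure.infinitePi fun _ => signLaw := by
  have hg : Function.Injective fun k : ℕ => n - (k : ℤ) := fun i j hij => by simpa using hij
  exact (h.precomp hg).map_eq

end Transform
-- Images of words of rank M as recurrent states
section Recurrence

variable {d : ℕ} {φ : E d → ℤˣ}

lemma ncard_wordRange_append_left {u : List ℤˣ}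
    (hu : (wordRange φ u).ncard = maxNonAccordable φ) (w : List ℤˣ) :
    (wordRange φ (u ++ w)).ncard = maxNonAccordable φ := by
  refine le_antisymm ?_ (maxNonAccordable_le_ncard _)
  rw [← hu, wordRange_append]
  exact Set.ncard_image_le (Set.toFinite _)

/-- A prefix can only shrink the image, which already has the minimal size: a word of rank M forgets
what came before it. -/
lemma wordRange_append_eq {w : List ℤˣ} (hw : (wordRange φ w).ncard = maxNonAccordable φ)
    (u : List ℤˣ) : wordRange φ (u ++ w) = wordRange φ w :=
  Set.eq_of_subset_of_ncard_le (wordRange_append_subset u w)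
    (hw ▸ maxNonAccordable_le_ncard _) (Set.toFinite _)

lemma image_steps_nil (A : Set (E d)) : steps φ [] '' A = A := Set.image_id A

lemma setChain_add (η : ℕ → ℤˣ) (A : Set (E d)) (n l : ℕ) :
    setChain φ η A (n + l) =
      steps φ (List.ofFn fun i : Fin l => η (n + i)) '' setChain φ η A n := by
  induction l with
  | zero => simp [image_steps_nil]
  | succ l ih =>
    rw [← add_assoc, setChain, ih, ← Set.image_comp, List.ofFn_succ', List.concat_eq_append]
    refine congrArg (· '' _) (funext fun x => ?_)
    simp [steps_append]

/-- The image of a word of rank `M` belongs to the class `𝒞`. -/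
lemma wordRange_mem_recurrentClass {w : List ℤˣ}
    (hw : (wordRange φ w).ncard = maxNonAccordable φ) : wordRange φ w ∈ recurrentClass φ := by
  refine ⟨?_, hw⟩
  -- Each time `w` is read, the chain started at its image is back there. The default 1 is never
  -- used.
  filter_upwards [isCoinTossing_infinitePi.frequently_pattern (fun i => w.getD i 1) w.length]
    with η hη
  rw [frequently_atTop] at hη ⊢
  intro a
  obtain ⟨n, hn, hpat⟩ := hη a
  refine ⟨n + w.length, by omega, ?_⟩
  have hword : (List.ofFn fun i : Fin w.length => η (n + i)) = w := by
    refine List.ext_getElem (by simp) fun i h1 h2 => ?_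
    rw [List.getElem_ofFn, hpat i h2, List.getD_eq_getElem _ _ h2]
  rw [setChain_add, hword]
  have := setChain_add (φ := φ) η (wordRange φ w) 0 n
  rw [zero_add, setChain, ← wordRange_append] at this
  rw [this, ← wordRange_append, wordRange_append_eq hw]

instance : Nonempty (recurrentClass φ) := by
  obtain ⟨w, hw⟩ := exists_ncard_wordRange_eq φ
  exact ⟨⟨_, wordRange_mem_recurrentClass hw⟩⟩

lemma ncard_recurrentClass (A : recurrentClass φ) :
    (A : Set (E d)).ncard = maxNonAccordable φ := A.2.2

end Recurrence

/-! ### The governed chain as a function of the past -/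

section PastMap

variable {d : ℕ} {φ : E d → ℤˣ}

/-- The states compatible with an infinite past of driving signs. -/
def pastLimit (φ : E d → ℤˣ) (y : ℕ → ℤˣ) : Set (E d) := ⋂ m, wordRange φ (pastWord y m)

/-- The past of length `m` has rank `M`. -/
def IsSynchronizing (φ : E d → ℤˣ) (y : ℕ → ℤˣ) (m : ℕ) : Prop :=
  (wordRange φ (pastWord y m)).ncard = maxNonAccordable φ

lemma wordRange_pastWord_eq {y : ℕ → ℤˣ} {m : ℕ} (hm : IsSynchronizing φ y m) {k : ℕ}
    (hk : m ≤ k) : wordRange φ (pastWord y k) = wordRange φ (pastWord y m) := by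
  obtain ⟨l, rfl⟩ := Nat.exists_eq_add_of_le hk
  rw [pastWord_add, wordRange_append_eq hm]

lemma IsSynchronizing.mono {y : ℕ → ℤˣ} {m : ℕ} (hm : IsSynchronizing φ y m) {k : ℕ}
    (hk : m ≤ k) : IsSynchronizing φ y k := by
  rw [IsSynchronizing, wordRange_pastWord_eq hm hk]; exact hm

lemma IsSynchronizing.pastLimit_eq {y : ℕ → ℤˣ} {m : ℕ} (hm : IsSynchronizing φ y m) :
    pastLimit φ y = wordRange φ (pastWord y m) := by
  refine (Set.iInter_subset _ m).antisymm (Set.subset_iInter fun k => ?_)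
  rcases le_total m k with h | h
  · rw [wordRange_pastWord_eq hm h]
  · obtain ⟨l, rfl⟩ := Nat.exists_eq_add_of_le h
    rw [pastWord_add]
    exact wordRange_append_subset _ _

lemma measurable_comp_pastWord {β : Type*} [MeasurableSpace β] (f : List ℤˣ → β) (m : ℕ) :
    Measurable fun y => f (pastWord y m) :=
  (measurable_of_finite fun u : Fin m → ℤˣ => f (List.ofFn u).reverse).comp
    (measurable_pi_iff.2 fun _ => measurable_pi_apply _)

lemma measurableSet_isSynchronizing (m : ℕ) : MeasurableSet {y | IsSynchronizing φ y m} :=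
  measurableSet_setOfPred.2
    (measurable_comp_pastWord (fun w => (wordRange φ w).ncard = maxNonAccordable φ) m)

/-- Some word of rank M almost surely occurs in the past, and the more recent letters appended to it
keep rank M. The pattern is reversed because `y` is indexed backwards in time. -/
lemma ae_exists_isSynchronizing (φ : E d → ℤˣ) :
    ∀ᵐ y ∂(Measure.infinitePi fun _ : ℕ => signLaw), ∃ m, IsSynchronizing φ y m := by
  obtain ⟨w, hw⟩ := exists_ncard_wordRange_eq φ
  filter_upwards [isCoinTossing_infinitePi.frequently_pattern
    (fun i => w.reverse.getD i 1) w.length] with y hy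
  obtain ⟨n, hn⟩ := hy.exists
  refine ⟨n + w.length, ?_⟩
  have hword : pastWord (fun i => y (n + i)) w.length = w := by
    rw [pastWord, List.reverse_eq_iff]
    refine List.ext_getElem (by simp) fun i h1 h2 => ?_
    rw [List.getElem_ofFn, hn i (by simpa using h2), List.getD_eq_getElem _ _ h2]
  rw [IsSynchronizing, pastWord_add, hword]
  exact ncard_wordRange_append_left hw _

open Classical in
/-- The map expressing the chain governed by a coin-tossing game through its past. -/
noncomputable def pastMap (φ : E d → ℤˣ) (y : ℕ → ℤˣ) : recurrentClass φ :=
  if h : pastLimit φ y ∈ recurrentClass φ then ⟨_, h⟩ else Classical.arbitrary _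

lemma IsSynchronizing.coe_pastMap {y : ℕ → ℤˣ} {m : ℕ} (hm : IsSynchronizing φ y m) :
    (pastMap φ y : Set (E d)) = wordRange φ (pastWord y m) := by
  have h : pastLimit φ y ∈ recurrentClass φ :=
    hm.pastLimit_eq ▸ wordRange_mem_recurrentClass hm
  rw [pastMap, dif_pos h]
  exact hm.pastLimit_eq

lemma measurable_pastMap : Measurable (pastMap φ) := by
  classical
  have h : Measurable (pastLimit φ) := by
    refine measurable_set_iff.2 fun a => ?_
    simp only [pastLimit, Set.mem_iInter]
    exact Measurable.forall fun m => measurable_comp_pastWord (fun w => a ∈ wordRange φ w) m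
  exact (measurable_of_finite fun A : Set (E d) =>
    if h : A ∈ recurrentClass φ then (⟨A, h⟩ : recurrentClass φ)
      else Classical.arbitrary _).comp h

lemma IsSynchronizing.past_succ {x : ℤ → ℤˣ} {n : ℤ} {m : ℕ}
    (hm : IsSynchronizing φ (past x (n - 1)) m) : IsSynchronizing φ (past x n) (m + 1) := by
  rw [IsSynchronizing, pastWord_past_succ]
  exact ncard_wordRange_append_left hm _

lemma coe_pastMap_past {x : ℤ → ℤˣ} {n : ℤ} {m : ℕ}
    (hm : IsSynchronizing φ (past x (n - 1)) m) :
    (pastMap φ (past x n) : Set (E d)) =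
      step φ (x n) '' (pastMap φ (past x (n - 1)) : Set (E d)) := by
  rw [hm.coe_pastMap, hm.past_succ.coe_pastMap, pastWord_past_succ, wordRange_append]
  rfl

variable {Ω : Type*} [MeasurableSpace Ω] {P : Measure Ω} {η : ℤ → Ω → ℤˣ}

lemma IsCoinTossing.ae_past (h : IsCoinTossing P η) {p : (ℕ → ℤˣ) → Prop}
    (hp : ∀ᵐ y ∂(Measure.infinitePi fun _ : ℕ => signLaw), p y) :
    ∀ᵐ ω ∂P, ∀ n, p (past (fun k => η k ω) n) := by
  refine ae_all_iff.2 fun n => ?_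
  rw [← h.map_past n] at hp
  exact ae_of_ae_map ((measurable_past n).comp h.measurable_seq).aemeasurable hp

lemma measurable_pastMap_past (n : ℤ) :
    Measurable fun x : ℤ → ℤˣ => pastMap φ (past x n) :=
  measurable_pastMap.comp (measurable_past n)

/-- The canonical past map turns every coin-tossing game into a governed chain. -/
lemma isGovernedChain_pastMap (h : IsCoinTossing P η) (φ : E d → ℤˣ) :
    IsGovernedChain φ P η fun n ω => pastMap φ (past (fun k => η k ω) n) where
  coinTossing := h
  measurable n := (measurable_pastMap_past n).comp h.measurable_seq
  rec_eq := by
    filter_upwards [h.ae_past (ae_exists_isSynchronizing φ)] with ω hω n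
    obtain ⟨m, hm⟩ := hω (n - 1)
    exact coe_pastMap_past hm
  indep_past n := by
    have hdisj : Disjoint ({n} : Set ℤ) (Set.Iio n) := by simp
    have hi := iIndepFun_indepFun_of_disjoint h.indep h.measurable hdisj
    have hlt (k : Set.Iio n) (j : ℕ) : (k : ℤ) - j < n := by
      have : (k : ℤ) < n := k.2
      omega
    have h1 : Measurable fun (u : Set.Iio n → ℤˣ) (k : Set.Iio n) =>
        pastMap φ fun j => u ⟨(k : ℤ) - j, hlt k j⟩ :=
      measurable_pi_iff.2 fun k => measurable_pastMap.comp
        (measurable_pi_iff.2 fun j => measurable_pi_apply _)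
    exact hi.comp (measurable_pi_apply (⟨n, rfl⟩ : ({n} : Set ℤ))) h1

/-- The value of the chain at time `n` is the image of an earlier value by the past word, hence lies
in the image of that word; both sets have M elements once the word has rank M. -/
lemma IsGovernedChain.isPastMap {X : ℤ → Ω → recurrentClass φ}
    (h : IsGovernedChain φ P η X) : IsPastMap φ P η X (pastMap φ) where
  measurable := measurable_pastMap
  eq_past := by
    filter_upwards [h.rec_eq, h.coinTossing.ae_past (ae_exists_isSynchronizing φ)]
      with ω hrec hsync n
    obtain ⟨m, hm⟩ := hsync n
    have himage : ∀ k : ℕ, (X n ω : Set (E d)) =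
        steps φ (pastWord (past (fun k => η k ω) n) k) '' (X (n - k) ω : Set (E d)) := by
      intro k
      induction k with
      | zero => simp [image_steps_nil]
      | succ k ih =>
        rw [ih, hrec (n - k), ← Set.image_comp, pastWord_succ]
        have : n - (k + 1 : ℕ) = n - k - 1 := by push_cast; ring
        rw [this]
        rfl
    refine Subtype.ext ?_
    rw [hm.coe_pastMap]
    refine Set.eq_of_subset_of_ncard_le ?_ ?_ (Set.toFinite _)
    · rw [himage m]
      exact Set.image_subset_range _ _
    · rw [ncard_recurrentClass, hm]

/-- Pasts of all coin-tossing games have the same law, so this makes `F` usable on the past of Φ(ε),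
even when `X` lives on another probability space. -/
lemma IsPastMap.ae_eq {X : ℤ → Ω → recurrentClass φ} {F : (ℕ → ℤˣ) → recurrentClass φ}
    (hF : IsPastMap φ P η X F) (h : IsGovernedChain φ P η X) :
    ∀ᵐ y ∂(Measure.infinitePi fun _ : ℕ => signLaw), F y = pastMap φ y := by
  have hm : Measurable fun ω => past (fun k => η k ω) 0 :=
    (measurable_past 0).comp h.coinTossing.measurable_seq
  rw [← h.coinTossing.map_past 0, ae_map_iff hm.aemeasurable (measurableSet_eq_fun hF.measurable measurable_pastMap)]
  filter_upwards [hF.eq_past, h.isPastMap.eq_past] with ω h1 h2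
  rw [← h1, h2]

end PastMap
-- Conditional law of a block
section ConditionalLaw

variable {d : ℕ} {φ : E d → ℤˣ}

/-- The kernel which sends a sequence to the uniform law on the value of the past map at its past
up to time `n`. -/
noncomputable def pastKernel (φ : E d → ℤˣ) (n : ℤ) : Kernel (ℤ → ℤˣ) (E d) where
  toFun x := uniformOn (pastMap φ (past x n) : Set (E d))
  measurable' := (measurable_of_finite fun A : recurrentClass φ =>
    uniformOn (A : Set (E d))).comp (measurable_pastMap_past n)

lemma pastKernel_apply (n : ℤ) (x : ℤ → ℤˣ) :
    pastKernel φ n x = uniformOn (pastMap φ (past x n) : Set (E d)) := rfl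

instance (n : ℤ) : IsMarkovKernel (pastKernel φ n) where
  isProbabilityMeasure x := by
    refine isProbabilityMeasure_uniformOn (Set.toFinite _) ?_
    rw [← Set.ncard_pos, ncard_recurrentClass]
    exact maxNonAccordable_pos φ

/-- Sequences whose past of length `m` up to time `n` has rank `M`. -/
def syncSet (φ : E d → ℤˣ) (n : ℤ) (m : ℕ) : Set (ℤ → ℤˣ) :=
  {x | IsSynchronizing φ (past x n) m}

lemma measurableSet_syncSet (n : ℤ) (m : ℕ) : MeasurableSet (syncSet φ n m) :=
  measurable_past n (measurableSet_isSynchronizing m)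

lemma monotone_syncSet (n : ℤ) : Monotone (syncSet φ n) := fun _ _ h _ hx => hx.mono h

variable {Ω : Type*} [MeasurableSpace Ω] {P : Measure Ω} {ε : ℤ → Ω → ℤˣ}

lemma IsCoinTossing.measurable_transform_seq (h : IsCoinTossing P ε) (φ : E d → ℤˣ) :
    Measurable fun ω => CoinToss.transform φ fun k => ε k ω :=
  CoinToss.measurable_transform.comp h.measurable_seq

lemma IsCoinTossing.measurable_block_seq (h : IsCoinTossing P ε) (n : ℤ) :
    Measurable fun ω => block d (fun k => ε k ω) n :=
  (measurable_block n).comp h.measurable_seq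

lemma pastWord_congr {y z : ℕ → ℤˣ} {m : ℕ} (h : ∀ k < m, y k = z k) :
    pastWord y m = pastWord z m := by
  rw [pastWord, pastWord]
  congr 2
  funext i
  exact h i i.2

lemma past_congr {x y : ℤ → ℤˣ} {n : ℤ} {m : ℕ} (h : ∀ k, n - m < k → x k = y k) :
    pastWord (past x n) m = pastWord (past y n) m :=
  pastWord_congr fun k hk => h _ (by omega)

/-- The disintegration identity, on events which depend only on the driving signs after time
`n - m` and on which these signs have rank `M`. -/
lemma IsCoinTossing.measure_inter_syncSet [IsProbabilityMeasure P] (h : IsCoinTossing P ε) (n : ℤ) (m : ℕ)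
    {D : Set (ℤ → ℤˣ)} (hD : MeasurableSet D)
    (hD' : ∀ x y : ℤ → ℤˣ, (∀ k, n - m < k → x k = y k) → (x ∈ D ↔ y ∈ D)) (t : Set (E d)) :
    (P.restrict ((fun ω => block d (fun k => ε k ω) n) ⁻¹' t)).map
        (fun ω => CoinToss.transform φ fun k => ε k ω) (D ∩ syncSet φ n m) =
      ((P.map fun ω => CoinToss.transform φ fun k => ε k ω).withDensity
        fun x => pastKernel φ n x t) (D ∩ syncSet φ n m) := by
  set s := n - m with hs
  set Y : Ω → ℤ → ℤˣ := fun ω => CoinToss.transform φ fun k => ε k ω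
  have hY : Measurable Y := h.measurable_transform_seq φ
  have hR := measurableSet_syncSet (φ := φ) n m
  have hR' : ∀ x y : ℤ → ℤˣ, (∀ k, s < k → x k = y k) →
      (x ∈ syncSet φ n m ↔ y ∈ syncSet φ n m) := fun x y hxy => by
    simp only [syncSet, IsSynchronizing, Set.mem_ofPred_eq, past_congr hxy]
  let z : Ω → Set.Ioi s → ℤˣ := fun ω k => Y ω k
  have hz : Measurable z := measurable_pi_iff.2 fun k => (measurable_pi_apply _).comp hY
  let b : Ω → E d := fun ω => block d (fun k => ε k ω) s
  have hb : Measurable b := h.measurable_block_seq s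
  classical
  -- The filling value is immaterial: `D`, the rank condition and the word depend only on times
  -- after `s`.
  let ext : (Set.Ioi s → ℤˣ) → ℤ → ℤˣ := fun u k => if hk : s < k then u ⟨k, hk⟩ else 1
  have hext : Measurable ext := by
    refine measurable_pi_iff.2 fun k => ?_
    by_cases hk : s < k
    · simpa only [ext, hk, dif_pos] using measurable_pi_apply _
    · simp only [ext, hk, dif_neg, not_false_iff, measurable_const]
  have hextz (ω) : ∀ k, s < k → ext (z ω) k = Y ω k := fun k hk => by simp [ext, z, hk]
  let W : (ℤ → ℤˣ) → List ℤˣ := fun x => pastWord (past x n) m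
  have hW (ω) : W (ext (z ω)) = W (Y ω) := past_congr (hextz ω)
  have hblock (ω) : block d (fun k => ε k ω) n = steps φ (W (Y ω)) (b ω) :=
    block_eq_steps _ n m
  let S : Set (E d × (Set.Ioi s → ℤˣ)) :=
    {p | ext p.2 ∈ D ∩ syncSet φ n m ∧ steps φ (W (ext p.2)) p.1 ∈ t}
  have hS : MeasurableSet S := by
    have hst : Measurable fun p : E d × (Set.Ioi s → ℤˣ) => steps φ (W (ext p.2)) p.1 :=
      measurable_from_prod_countable_right fun x =>
        (measurable_comp_pastWord (fun w => steps φ w x) m).comp ((measurable_past n).comp hext)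
    exact (hext.comp measurable_snd (hD.inter hR)).inter (hst (Set.toFinite t).measurableSet)
  have hlaw : P.map (fun ω => (b ω, z ω)) = (uniformOn Set.univ).prod (P.map z) := by
    rw [← h.map_block s]
    exact (h.indepFun_block_transform φ s).map_prod_eq_prod_map_map hb.aemeasurable
      hz.aemeasurable
  have hDR := hD.inter hR
  rw [Measure.map_apply hY hDR, Measure.restrict_apply (hY hDR), withDensity_apply _ hDR,
    setLIntegral_map hDR (Kernel.measurable_coe _ (Set.toFinite t).measurableSet) hY]
  have hset : Y ⁻¹' (D ∩ syncSet φ n m) ∩ (fun ω => block d (fun k => ε k ω) n) ⁻¹' t =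
      (fun ω => (b ω, z ω)) ⁻¹' S := by
    ext ω
    simp only [S, Set.mem_inter_iff, Set.mem_preimage, Set.mem_ofPred_eq, hW, hblock,
      hD' _ _ (hextz ω), hR' _ _ (hextz ω)]
  rw [hset, ← Measure.map_apply (hb.prodMk hz) hS, hlaw, Measure.prod_apply_symm hS,
    lintegral_map (measurable_measure_prodMk_right hS) hz, ← lintegral_indicator (hY hDR)]
  refine lintegral_congr fun ω => ?_
  have hsec : (fun x => (x, z ω)) ⁻¹' S =
      {x | Y ω ∈ D ∩ syncSet φ n m ∧ steps φ (W (Y ω)) x ∈ t} := by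
    ext x
    simp only [S, Set.mem_inter_iff, Set.mem_preimage, Set.mem_ofPred_eq, hW,
      hD' _ _ (hextz ω), hR' _ _ (hextz ω)]
  rw [hsec]
  by_cases hω : Y ω ∈ D ∩ syncSet φ n m
  -- With the later signs frozen, the block at `n` is the image of a uniform block by a word of rank
  -- M.
  · have hsync : IsSynchronizing φ (past (Y ω) n) m := hω.2
    rw [Set.indicator_of_mem (by exact hω), pastKernel_apply, hsync.coe_pastMap,
      ← map_steps_uniformOn hsync,
      Measure.map_apply (measurable_of_finite _) (Set.toFinite t).measurableSet]
    simp only [hω, true_and]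
    rfl
  · rw [Set.indicator_of_notMem (by exact hω)]
    simp [hω]

/-- The conditional law of a block of `ε` given `Φ(ε)`. -/
lemma IsCoinTossing.condDistrib_block [IsProbabilityMeasure P] (h : IsCoinTossing P ε) (φ : E d → ℤˣ) (n : ℤ) :
    condDistrib (fun ω => block d (fun k => ε k ω) n)
        (fun ω => CoinToss.transform φ fun k => ε k ω) P
      =ᵐ[P.map fun ω => CoinToss.transform φ fun k => ε k ω] pastKernel φ n := by
  set Y : Ω → ℤ → ℤˣ := fun ω => CoinToss.transform φ fun k => ε k ω
  have hY : Measurable Y := h.measurable_transform_seq φ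
  set B : Ω → E d := fun ω => block d (fun k => ε k ω) n
  have hB : Measurable B := h.measurable_block_seq n
  have hprob : IsProbabilityMeasure (P.map Y) := Measure.isProbabilityMeasure_map hY.aemeasurable
  refine condDistrib_ae_eq_of_measure_eq_compProd _ hB.aemeasurable ?_
  refine Measure.ext_prod fun {D t} hD ht => ?_
  rw [Measure.map_apply (hY.prodMk hB) (hD.prod ht), Measure.compProd_apply_prod hD ht,
    ← withDensity_apply _ hD, Set.mk_preimage_prod, ← Measure.restrict_apply (hY hD),
    ← Measure.map_apply hY hD]
  congr 1
  have hsync : ∀ᵐ x ∂(P.map Y), x ∈ ⋃ m, syncSet φ n m := by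
    have hm : MeasurableSet {x | x ∈ ⋃ m, syncSet φ n m} :=
      MeasurableSet.iUnion fun m => measurableSet_syncSet n m
    rw [ae_map_iff hY.aemeasurable hm]
    filter_upwards [(h.transform φ).ae_past (ae_exists_isSynchronizing φ)] with ω hω
    exact Set.mem_iUnion.2 (hω n)
  set μ₁ := (P.restrict (B ⁻¹' t)).map Y
  set μ₂ := (P.map Y).withDensity fun x => pastKernel φ n x t
  have hμ₁ : μ₁ ≪ P.map Y := (Measure.absolutelyContinuous_of_le Measure.restrict_le_self).map hY
  have hμ₂ : μ₂ ≪ P.map Y := withDensity_absolutelyContinuous _ _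
  -- For `m` large the times defining a cylinder all come after `n - m`, so the identity holds on
  -- its intersection with `syncSet φ n m`; these sets increase to a set of full measure.
  have hcyl : ∀ C ∈ measurableCylinders (fun _ : ℤ => ℤˣ), μ₁ C = μ₂ C := by
    intro C hC
    obtain ⟨I, C', hC', rfl⟩ := (mem_measurableCylinders _).1 hC
    obtain ⟨l, hl⟩ := I.bddBelow
    have hCm : MeasurableSet (cylinder (α := fun _ : ℤ => ℤˣ) I C') := MeasurableSet.cylinder I hC'
    have heq (m : ℕ) (hm : (n - l + 1).toNat ≤ m) :
        μ₁ (cylinder I C' ∩ syncSet φ n m) = μ₂ (cylinder I C' ∩ syncSet φ n m) := by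
      refine h.measure_inter_syncSet n m hCm (fun x y hxy => ?_) t
      have : I.restrict x = I.restrict y := funext fun k => hxy k (by
        have := hl k.2
        omega)
      rw [mem_cylinder, mem_cylinder, this]
    have hlim (μ : Measure (ℤ → ℤˣ)) (hμ : μ ≪ P.map Y) :
        Tendsto (fun m => μ (cylinder I C' ∩ syncSet φ n m)) atTop (nhds (μ (cylinder I C'))) := by
      have h1 : μ (cylinder I C') = μ (⋃ m, cylinder I C' ∩ syncSet φ n m) := by
        refine measure_congr ?_
        filter_upwards [hμ.ae_le hsync] with x hx
        rw [← Set.inter_iUnion]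
        exact propext ⟨fun hxC => ⟨hxC, hx⟩, fun hxC => hxC.1⟩
      rw [h1]
      exact tendsto_measure_iUnion_atTop fun a b hab =>
        Set.inter_subset_inter_right _ (monotone_syncSet n hab)
    refine tendsto_nhds_unique_of_eventuallyEq (hlim μ₁ hμ₁) (hlim μ₂ hμ₂) ?_
    filter_upwards [eventually_ge_atTop _] with m hm using heq m hm
  exact ext_of_generate_finite _ generateFrom_measurableCylinders.symm
    isPiSystem_measurableCylinders hcyl (hcyl _ (univ_mem_measurableCylinders _))

end ConditionalLaw
-- Conditional law of the whole sequence
section WholeSequence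

/-- A law carried by a set on which `f` is injective is uniform if its image by `f` is. -/
lemma eq_uniformOn_of_map_eq {α β : Type*} [MeasurableSpace α] [MeasurableSingletonClass α]
    [MeasurableSpace β] [MeasurableSingletonClass β] [Finite β] {μ : Measure α} {S : Set α}
    {A : Set β} {f : α → β} (hf : Measurable f) (hinj : Set.InjOn f S) (hfS : Set.MapsTo f S A)
    (hS : ∀ᵐ x ∂μ, x ∈ S) (hmap : μ.map f = uniformOn A) :
    S.Finite ∧ S.ncard = A.ncard ∧ μ = uniformOn S := by
  have hfin : S.Finite := Set.Finite.of_finite_image (Set.toFinite _) hinj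
  -- A point of `A` missed by `f` on `S` would have mass zero under the uniform law on `A`.
  have himage : f '' S = A := by
    refine hfS.image_subset.antisymm fun a ha => ?_
    by_contra hne
    have h0 : μ (f ⁻¹' {a}) = 0 := by
      rw [measure_eq_zero_iff_ae_notMem]
      filter_upwards [hS] with x hx hxa
      exact hne ⟨x, hx, hxa⟩
    rw [← Measure.map_apply hf (measurableSet_singleton a), hmap,
      uniformOn_eq_zero_iff (Set.toFinite A)] at h0
    exact (Set.ext_iff.1 h0 a).1 ⟨ha, rfl⟩
  refine ⟨hfin, by rw [← himage, hinj.ncard_image], Measure.ext fun D hD => ?_⟩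
  have h1 : μ D = μ (f ⁻¹' (f '' (S ∩ D))) := by
    refine measure_congr ?_
    filter_upwards [hS] with x hx
    refine propext ⟨fun hxD => ⟨x, ⟨hx, hxD⟩, rfl⟩, ?_⟩
    rintro ⟨y, ⟨hyS, hyD⟩, hyx⟩
    exact hinj hyS hx hyx ▸ hyD
  have hA : MeasurableSet A := (Set.toFinite A).measurableSet
  have hsub : f '' (S ∩ D) ⊆ A := (Set.image_mono Set.inter_subset_left).trans himage.subset
  rw [h1, ← Measure.map_apply hf (Set.toFinite _).measurableSet, hmap, uniformOn, uniformOn,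
    cond_apply hA, cond_apply hfin.measurableSet, Set.inter_eq_self_of_subset_right hsub,
    Measure.count_apply hA, Measure.count_apply (Set.toFinite _).measurableSet,
    Measure.count_apply hfin.measurableSet, Measure.count_apply (hfin.measurableSet.inter hD),
    ← himage, hinj.encard_image, (hinj.mono Set.inter_subset_left).encard_image]

variable {d : ℕ} {φ : E d → ℤˣ}

/-- The preimages of `y` under `Φ` whose blocks are compatible with the pasts of `y`. -/
def compatibleSet (φ : E d → ℤˣ) (y : ℤ → ℤˣ) : Set (ℤ → ℤˣ) :=
  {x | transform φ x = y ∧ ∀ n, block d x n ∈ (pastMap φ (past y n) : Set (E d))}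

/-- Forward, the recursion determines the next block; backward, `step` is injective on the value of
`pastMap`, since that value and its image both have M elements. As `d ≥ 1`, each entry can be read
off a block. -/
lemma injOn_block_compatibleSet (hd : 1 ≤ d) {y : ℤ → ℤˣ}
    (hy : ∀ n, ∃ m, IsSynchronizing φ (past y n) m) :
    Set.InjOn (fun x : ℤ → ℤˣ => block d x 0) (compatibleSet φ y) := by
  rintro x ⟨hx, hxb⟩ x' ⟨hx', hxb'⟩ (h0 : block d x 0 = block d x' 0)
  have hup (n : ℤ) (h : block d x (n - 1) = block d x' (n - 1)) :
      block d x n = block d x' n := by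
    rw [block_eq_step (φ := φ) x, block_eq_step (φ := φ) x', hx, hx', h]
  have hdown (n : ℤ) (h : block d x n = block d x' n) :
      block d x (n - 1) = block d x' (n - 1) := by
    obtain ⟨m, hm⟩ := hy (n - 1)
    have hinj : Set.InjOn (step φ (y n)) (pastMap φ (past y (n - 1)) : Set (E d)) := by
      refine Set.injOn_of_ncard_image_eq ?_ (Set.toFinite _)
      rw [← coe_pastMap_past hm, ncard_recurrentClass, ncard_recurrentClass]
    refine hinj (hxb _) (hxb' _) ?_
    rwa [block_eq_step (φ := φ) x, block_eq_step (φ := φ) x', hx, hx'] at h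
  have hall (n : ℤ) : block d x n = block d x' n := by
    induction n using Int.induction_on with
    | zero => exact h0
    | succ n ih => exact hup _ (by rwa [add_sub_cancel_right])
    | pred n ih => exact hdown _ ih
  funext n
  have := congrFun (hall n) ⟨d - 1, by omega⟩
  simp only [block] at this
  have hn : n - d + 1 + ((d - 1 : ℕ) : ℤ) = n := by omega
  rwa [hn] at this

variable {Ω : Type*} [MeasurableSpace Ω] {P : Measure Ω} [IsProbabilityMeasure P]
  {ε : ℤ → Ω → ℤˣ}

/-- The conditional law of `ε` given `Φ(ε)`. -/
lemma IsCoinTossing.condDistrib_seq (hd : 1 ≤ d) (h : IsCoinTossing P ε) (φ : E d → ℤˣ) :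
    ∀ᵐ ω ∂P, (compatibleSet φ (CoinToss.transform φ fun k => ε k ω)).Finite ∧
      (compatibleSet φ (CoinToss.transform φ fun k => ε k ω)).ncard = maxNonAccordable φ ∧
      condDistrib (fun ω' k => ε k ω') (fun ω' => CoinToss.transform φ fun k => ε k ω') P
          (CoinToss.transform φ fun k => ε k ω) =
        uniformOn (compatibleSet φ (CoinToss.transform φ fun k => ε k ω)) := by
  set Y : Ω → ℤ → ℤˣ := fun ω => CoinToss.transform φ fun k => ε k ω
  have hY : Measurable Y := h.measurable_transform_seq φ
  set X : Ω → ℤ → ℤˣ := fun ω k => ε k ω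
  have hX : Measurable X := h.measurable_seq
  have htransform : ∀ᵐ y ∂(P.map Y), ∀ᵐ x ∂(condDistrib X Y P y), CoinToss.transform φ x = y := by
    have hprob : IsProbabilityMeasure (P.map Y) :=
      Measure.isProbabilityMeasure_map hY.aemeasurable
    have hm : MeasurableSet {p : (ℤ → ℤˣ) × (ℤ → ℤˣ) | CoinToss.transform φ p.2 = p.1} :=
      measurableSet_eq_fun (CoinToss.measurable_transform.comp measurable_snd) measurable_fst
    refine Measure.ae_ae_of_ae_compProd (p := fun p => CoinToss.transform φ p.2 = p.1) ?_
    rw [compProd_map_condDistrib hX.aemeasurable,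
      ae_map_iff (hY.prodMk hX).aemeasurable hm]
    exact ae_of_all _ fun _ => rfl
  have hblock : ∀ᵐ y ∂(P.map Y), ∀ n,
      (condDistrib X Y P y).map (fun x => block d x n) = pastKernel φ n y := by
    refine ae_all_iff.2 fun n => ?_
    filter_upwards [h.condDistrib_block φ n, condDistrib_comp Y hX.aemeasurable
      (measurable_block (d := d) n)] with y h1 h2
    rw [← h1, ← Kernel.map_apply _ (measurable_block n), ← h2]
    rfl
  filter_upwards [ae_of_ae_map hY.aemeasurable htransform, ae_of_ae_map hY.aemeasurable hblock,
    (h.transform φ).ae_past (ae_exists_isSynchronizing φ)] with ω h1 h2 h3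
  rw [← ncard_recurrentClass (pastMap φ (past (Y ω) 0))]
  -- The conditional law is carried by `compatibleSet`, and its image under the block at time 0 is
  -- already known to be uniform on M states.
  refine eq_uniformOn_of_map_eq (measurable_block 0) (injOn_block_compatibleSet hd h3)
    (fun x hx => hx.2 0) ?_ (h2 0)
  have h4 : ∀ᵐ x ∂(condDistrib X Y P (Y ω)), ∀ n,
      block d x n ∈ (pastMap φ (past (Y ω) n) : Set (E d)) := by
    refine ae_all_iff.2 fun n => ae_of_ae_map (measurable_block n).aemeasurable
      (p := fun b => b ∈ (pastMap φ (past (Y ω) n) : Set (E d))) ?_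
    rw [h2 n, pastKernel_apply]
    exact ae_cond_mem (Set.toFinite _).measurableSet
  filter_upwards [h1, h4] with x hx hxb using ⟨hx, hxb⟩

end WholeSequence
end CoinToss

theorem mainTheorem3 (d : ℕ) (hd : 1 ≤ d) (φ : CoinToss.E d → ℤˣ)
    {Ω : Type*} [MeasurableSpace Ω] (P : Measure Ω) [IsProbabilityMeasure P]
    (ε : ℤ → Ω → ℤˣ) (hε : CoinToss.IsCoinTossing P ε) :
    -- a Markov chain on the class, governed by the signs `Φ(ε)`, exists
    (∃ X : ℤ → Ω → CoinToss.recurrentClass φ,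
      CoinToss.IsGovernedChain φ P
        (fun n ω => CoinToss.transform φ (fun k => ε k ω) n) X) ∧
    -- every governed chain provides a map `F`, and for every such `F` the conditional law of
    -- the block at time `n` given `Φ(ε)` is uniform on `F` of the past of `Φ(ε)` up to `n`
    (∀ (Ω' : Type*) [MeasurableSpace Ω'] (P' : Measure Ω') [IsProbabilityMeasure P']
      (η : ℤ → Ω' → ℤˣ) (X : ℤ → Ω' → CoinToss.recurrentClass φ),
      CoinToss.IsGovernedChain φ P' η X →
      (∃ F : (ℕ → ℤˣ) → CoinToss.recurrentClass φ, CoinToss.IsPastMap φ P' η X F) ∧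
      ∀ F : (ℕ → ℤˣ) → CoinToss.recurrentClass φ, CoinToss.IsPastMap φ P' η X F →
        ∀ᵐ ω ∂P, ∀ n : ℤ,
          condDistrib (fun ω' => CoinToss.block d (fun k => ε k ω') n)
              (fun ω' => CoinToss.transform φ (fun k => ε k ω')) P
              (CoinToss.transform φ (fun k => ε k ω)) =
            uniformOn (F (CoinToss.past (CoinToss.transform φ (fun k => ε k ω)) n) :
              Set (CoinToss.E d))) ∧
    -- the conditional law of the whole sequence `ε` given `Φ(ε)` is uniform on `M` values
    (∀ᵐ ω ∂P, ∃ S : Finset (ℤ → ℤˣ), S.card = CoinToss.maxNonAccordable φ ∧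
      condDistrib (fun ω' k => ε k ω')
          (fun ω' => CoinToss.transform φ (fun k => ε k ω')) P
          (CoinToss.transform φ (fun k => ε k ω)) =
        uniformOn (S : Set (ℤ → ℤˣ))) := by
  refine ⟨⟨_, CoinToss.isGovernedChain_pastMap (hε.transform φ) φ⟩,
    fun Ω' _ P' _ η X hX => ⟨⟨_, hX.isPastMap⟩, fun F hF => ?_⟩, ?_⟩
  · have hY := hε.measurable_transform_seq φ
    have hcond := ae_all_iff.2 fun n =>
      ae_of_ae_map hY.aemeasurable (hε.condDistrib_block φ n)
    -- `F` and `pastMap` agree almost surely on every past of Φ(ε), which is again a coin-tossing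
    -- game.
    filter_upwards [hcond, (hε.transform φ).ae_past (hF.ae_eq hX)] with ω h1 h2 n
    rw [h1 n, CoinToss.pastKernel_apply, ← h2 n]
  · filter_upwards [hε.condDistrib_seq hd φ] with ω hω
    obtain ⟨hfin, hcard, hlaw⟩ := hω
    refine ⟨hfin.toFinset, ?_, ?_⟩
    · rw [← hcard, Set.ncard_eq_toFinset_card _ hfin]
    · rw [hlaw, hfin.coe_toFinset]
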